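/- **Theorem 4.4.** For integers $2\le k\le n$, the bottom-to-top shuffle of $n$ cards is the Markov chain on $S_n$ in which, at each step, a card chosen uniformly at random among the bottom $k$ cards of the deck is moved to the top, the relative order of the other cards being unchanged; its stationary distribution is uniform on $S_n$. Let $$\tau_{\mathrm{mix}}(n,k)=\max_{s\in S_n}\min\Bigl\{t\ge 0:\ \tfrac12\sum_{x\in S_n}\bigl|P(X_t=x\mid X_0=s)-\tfrac1{n!}\bigr|\le\tfrac14\Bigr\}$$ be its mixing time. Let $(k(n))_n$ be a sequence of integers with $2\le k=k(n)\le n$ for all large $n$. 1. If $k=o(n)$ as $n\to\infty$, then there are real numbers $\varepsilon_n\to0$ such that, for all large $n$, $$\tau_{\mathrm{mix}}(n,k)\ \ge\ (1+\varepsilon_n)\,\frac{n^3}{4\pi^2k(k-1)}\,\log n .$$ 2. If $k=\Theta(n)$, then $\tau_{\mathrm{mix}}(n,k)=\Omega(n\log n)$: there is a constant $c>0$ such that $\tau_{\mathrm{mix}}(n,k)\ge c\,n\log n$ for all large $n$. -/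

import Mathlib

open Filter Asymptotics
open scoped Topology ENNReal

/-- Total variation distance of two mass functions on a finite set. -/
noncomputable def tvDist {S : Type*} [Fintype S] (μ ν : S → ℝ) : ℝ :=
  (1 / 2) * ∑ x, |μ x - ν x|

/-- `τ(s)`: the first time `t` at which the law of the chain with transition matrix `P` started
at `s` (row `s` of `P ^ t`) is within total variation distance `1/4` of `π`; it is `∞` if there
is no such time. -/
noncomputable def mixingTimeFrom {S : Type*} [Fintype S] [DecidableEq S]
    (P : Matrix S S ℝ) (π : S → ℝ) (s : S) : ℕ∞ :=
  ⨅ (t : ℕ) (_ : tvDist ((P ^ t) s) π ≤ 1 / 4), (t : ℕ∞)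

/-- The mixing time, the maximum of `τ(s)` over all starting states `s`. -/
noncomputable def mixingTime {S : Type*} [Fintype S] [DecidableEq S]
    (P : Matrix S S ℝ) (π : S → ℝ) : ℕ∞ :=
  ⨆ s, mixingTimeFrom P π s

/-- A deck of `n` cards is a permutation `s` of `Fin n`: `s i` is the card at position `i`, with
position `0` the top and position `n - 1` the bottom. `moveToTop j s` is the deck after the card
at position `j` has been moved to the top: `Fin.cycleRange j` sends position `j` to `0`, sends
each position `i < j` to `i + 1`, and fixes the positions below `j`. -/
def moveToTop {n : ℕ} (j : Fin n) (s : Equiv.Perm (Fin n)) : Equiv.Perm (Fin n) :=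
  s * (Fin.cycleRange j)⁻¹

/-- Transition matrix of the shuffle that moves the card at position `j` to the top with
probability `p j`. -/
noncomputable def moveToTopMatrix {n : ℕ} (p : Fin n → ℝ) :
    Matrix (Equiv.Perm (Fin n)) (Equiv.Perm (Fin n)) ℝ :=
  fun s s' => ∑ j, if moveToTop j s = s' then p j else 0

/-- The uniform distribution on the bottom `k` of the `n` positions. -/
noncomputable def bottomWeight (n k : ℕ) (j : Fin n) : ℝ :=
  if n ≤ (j : ℕ) + k then 1 / (k : ℝ) else 0

/-- Transition matrix of the bottom-to-top shuffle of `n` cards: a uniformly chosen card among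
the bottom `k` is moved to the top. -/
noncomputable def bottomToTopMatrix (n k : ℕ) :
    Matrix (Equiv.Perm (Fin n)) (Equiv.Perm (Fin n)) ℝ :=
  moveToTopMatrix (bottomWeight n k)

/-- The uniform distribution on the decks of `n` cards, the stationary distribution of the
shuffle. -/
noncomputable def uniformDeck (n : ℕ) (_ : Equiv.Perm (Fin n)) : ℝ :=
  1 / (Nat.factorial n : ℝ)

/-- Mixing time of the bottom-to-top shuffle of `n` cards with parameter `k`. -/
noncomputable def bottomToTopMixingTime (n k : ℕ) : ℕ∞ :=
  mixingTime (bottomToTopMatrix n k) (uniformDeck n)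

theorem bottomWeight_sum (n k : ℕ) (hk : 0 < k) (hkn : k ≤ n) :
    ∑ j, bottomWeight n k j = 1 := by
  unfold bottomWeight
  rw [Finset.sum_ite, Finset.sum_const_zero, add_zero, Finset.sum_const]
  have h : (Finset.univ.filter (fun j : Fin n => n ≤ (j : ℕ) + k)).card = k := by
    have h2 : (Finset.univ.filter (fun j : Fin n => n ≤ (j : ℕ) + k)).map Fin.valEmbedding =
        Finset.Ico (n - k) n := by
      ext x
      simp only [Finset.mem_map, Finset.mem_filter, Finset.mem_univ, true_and,
        Fin.valEmbedding_apply, Finset.mem_Ico]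
      constructor
      · rintro ⟨j, h, rfl⟩
        have := j.2
        omega
      · rintro ⟨h1, h2⟩
        exact ⟨⟨x, h2⟩, by simp; omega, rfl⟩
    rw [← Finset.card_map Fin.valEmbedding, h2, Nat.card_Ico]
    omega
  rw [h]
  simp
  field_simp

theorem bottomToTopMatrix_row_sum (n k : ℕ) (hk : 0 < k) (hkn : k ≤ n)
    (s : Equiv.Perm (Fin n)) : ∑ s', bottomToTopMatrix n k s s' = 1 := by
  unfold bottomToTopMatrix moveToTopMatrix
  rw [Finset.sum_comm]
  simpa using bottomWeight_sum n k hk hkn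

/-- The uniform distribution is stationary for the bottom-to-top shuffle. -/
theorem uniformDeck_stationary (n k : ℕ) (hk : 0 < k) (hkn : k ≤ n) :
    Matrix.vecMul (uniformDeck n) (bottomToTopMatrix n k) = uniformDeck n := by
  ext s'
  simp only [Matrix.vecMul, dotProduct, uniformDeck, bottomToTopMatrix, moveToTopMatrix]
  rw [← Finset.mul_sum, Finset.sum_comm]
  have h : ∀ j : Fin n, ∑ s, (if moveToTop j s = s' then bottomWeight n k j else 0) =
      bottomWeight n k j := by
    intro j
    simp only [moveToTop, mul_inv_eq_iff_eq_mul]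
    simp
  simp [h, bottomWeight_sum n k hk hkn]

/-! Both bounds start from the ordered deck. For `k = o(n)` the method is Wilson's. A single card
descends deterministically to the bottom block, stays there, and returns to the top with probability
`1/k` per step; its motion has eigenfunction `lam ^ min i (n - k)` as soon as `lam ^ (n - k) * (1 +
k * (lam - 1)) = 1`. Summing over cards gives an eigenfunction of the deck
(`sum_bottomToTopMatrix_smul_deckFunction`), of size about `n` at the start and with fluctuations of
order `√n`. It stays detectable until `|lam| ^ (2t)` is of order `1/n`. Writing `lam = exp z`, the
root near `2πi/n` has `Re z = -2π²k(k-1)/n³ + O(k³/n⁴)` (`exists_card_eigenvalue`), which yields the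
sharp constant with relative error `O(k/n) + O(1/log n)`.

For `k = Θ(n)` the observable is the length `U` of the increasing run at the bottom. It drops by at
most one, with probability at most `U/k`, so `E[1/(U+1)]` grows by a factor at most `1 + 1/k` per
step and `U` stays large up to time about `k log n` (`mul_log_le_of_tvDist_le`). -/

/-! ### Finite Markov chains and Wilson's method -/

section Chain

variable {S : Type*} [Fintype S] [DecidableEq S]

theorem ofReal_le_mixingTime (P : Matrix S S ℝ) (π : S → ℝ) (s : S) (B : ℝ)
    (h : ∀ t : ℕ, tvDist ((P ^ t) s) π ≤ 1 / 4 → B ≤ t) :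
    ENNReal.ofReal B ≤ (mixingTime P π : ℝ≥0∞) := by
  have h1 : ((⌈B⌉₊ : ℕ) : ℕ∞) ≤ mixingTime P π := by
    refine le_trans ?_ (le_iSup (mixingTimeFrom P π) s)
    refine le_iInf₂ fun t ht => ?_
    exact_mod_cast Nat.ceil_le.2 (h t ht)
  calc ENNReal.ofReal B ≤ ENNReal.ofReal (⌈B⌉₊ : ℝ) :=
        ENNReal.ofReal_le_ofReal (Nat.le_ceil B)
    _ = (((⌈B⌉₊ : ℕ) : ℕ∞) : ℝ≥0∞) := by simp
    _ ≤ _ := ENat.toENNReal_le.2 h1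

theorem sum_pow_succ_smul {E : Type*} [AddCommGroup E] [Module ℝ E] (P : Matrix S S ℝ)
    (F : S → E) (t : ℕ) (s : S) :
    ∑ x, (P ^ (t + 1)) s x • F x = ∑ y, (P ^ t) s y • ∑ x, P y x • F x := by
  simp only [pow_succ, Matrix.mul_apply, Finset.sum_smul, Finset.smul_sum, mul_smul]
  exact Finset.sum_comm

theorem sum_pow_zero_smul {E : Type*} [AddCommGroup E] [Module ℝ E] (P : Matrix S S ℝ)
    (F : S → E) (s : S) : ∑ x, (P ^ 0) s x • F x = F s := by
  simp [Matrix.one_apply]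

theorem pow_row_nonneg (P : Matrix S S ℝ) (h0 : ∀ x y, 0 ≤ P x y) (t : ℕ) (s x : S) :
    0 ≤ (P ^ t) s x := by
  induction t generalizing x with
  | zero => rw [pow_zero, Matrix.one_apply]; split_ifs <;> norm_num
  | succ t ih =>
    rw [pow_succ, Matrix.mul_apply]
    exact Finset.sum_nonneg fun y _ => mul_nonneg (ih y) (h0 y x)

theorem pow_row_sum (P : Matrix S S ℝ) (h1 : ∀ x, ∑ y, P x y = 1) (t : ℕ) (s : S) :
    ∑ x, (P ^ t) s x = 1 := by
  induction t with
  | zero => simpa using sum_pow_zero_smul P (fun _ => (1 : ℝ)) s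
  | succ t ih => simpa [h1, ih] using sum_pow_succ_smul P (fun _ => (1 : ℝ)) t s

theorem sum_pow_le_of_superharmonic (P : Matrix S S ℝ) (h0 : ∀ x y, 0 ≤ P x y) (F : S → ℝ)
    (c : ℝ) (hc : 0 ≤ c) (hF : ∀ x, ∑ y, P x y * F y ≤ c * F x) (t : ℕ) (s : S) :
    ∑ x, (P ^ t) s x * F x ≤ c ^ t * F s := by
  induction t with
  | zero => simpa using (sum_pow_zero_smul P F s).le
  | succ t ih =>
    have h := sum_pow_succ_smul P F t s
    simp only [smul_eq_mul] at h
    rw [h]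
    calc ∑ y, (P ^ t) s y * ∑ x, P y x * F x ≤ ∑ y, c * ((P ^ t) s y * F y) := by
          refine Finset.sum_le_sum fun y _ => ?_
          rw [mul_left_comm]
          exact mul_le_mul_of_nonneg_left (hF y) (pow_row_nonneg P h0 t s y)
      _ = c * ∑ y, (P ^ t) s y * F y := by rw [Finset.mul_sum]
      _ ≤ c * (c ^ t * F s) := mul_le_mul_of_nonneg_left ih hc
      _ = _ := by ring

omit [DecidableEq S] in
theorem sum_le_sum_add_tvDist (μ π : S → ℝ) (hμ : ∑ x, μ x = 1) (hπ : ∑ x, π x = 1)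
    (F : S → ℝ) (hF0 : ∀ x, 0 ≤ F x) (hF1 : ∀ x, F x ≤ 1) :
    ∑ x, π x * F x ≤ ∑ x, μ x * F x + tvDist μ π := by
  have h : ∀ x, π x * F x ≤ μ x * F x + (1 / 2) * |μ x - π x| + (1 / 2) * (π x - μ x) := by
    intro x
    have := hF0 x
    have := hF1 x
    rcases abs_cases (μ x - π x) with ⟨h1, h2⟩ | ⟨h1, h2⟩ <;> rw [h1] <;> nlinarith
  have := Finset.sum_le_sum fun x (_ : x ∈ Finset.univ) => h x
  simp only [Finset.sum_add_distrib, ← Finset.mul_sum, Finset.sum_sub_distrib, hμ, hπ] at this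
  unfold tvDist
  linarith

omit [DecidableEq S] in
-- The overlap `min (μ x) (π x) = (μ x + π x - |μ x - π x|) / 2` has total mass `1 - tvDist μ π`.
-- Integrating `‖m‖² ≤ 2(‖Φ - m‖² + ‖Φ‖²)` against it gives the bound: two nearly equal laws cannot
-- concentrate `Φ` near both `m` and `0`.
theorem one_sub_tvDist_mul_le (μ π : S → ℝ) (hμ0 : ∀ x, 0 ≤ μ x) (hπ0 : ∀ x, 0 ≤ π x)
    (hμ : ∑ x, μ x = 1) (hπ : ∑ x, π x = 1) (Φ : S → ℂ) (m : ℂ) :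
    (1 - tvDist μ π) * ‖m‖ ^ 2 ≤
      2 * (∑ x, μ x * ‖Φ x - m‖ ^ 2 + ∑ x, π x * ‖Φ x‖ ^ 2) := by
  have h : ∀ x, (1 / 2) * (μ x + π x - |μ x - π x|) * ‖m‖ ^ 2 ≤
      2 * (μ x * ‖Φ x - m‖ ^ 2 + π x * ‖Φ x‖ ^ 2) := by
    intro x
    have h1 : ‖m‖ ≤ ‖Φ x - m‖ + ‖Φ x‖ := by
      calc ‖m‖ = ‖Φ x - (Φ x - m)‖ := by congr 1; ring
        _ ≤ ‖Φ x‖ + ‖Φ x - m‖ := norm_sub_le _ _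
        _ = _ := add_comm _ _
    have h2 : ‖m‖ ^ 2 ≤ 2 * (‖Φ x - m‖ ^ 2 + ‖Φ x‖ ^ 2) := by
      have := pow_le_pow_left₀ (norm_nonneg m) h1 2
      nlinarith [sq_nonneg (‖Φ x - m‖ - ‖Φ x‖)]
    have ha := sq_nonneg ‖Φ x - m‖
    have hb := sq_nonneg ‖Φ x‖
    have := hμ0 x
    have := hπ0 x
    rcases abs_cases (μ x - π x) with ⟨h3, h4⟩ | ⟨h3, h4⟩ <;> rw [h3]
    · have := mul_le_mul_of_nonneg_left h2 (hπ0 x)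
      have := mul_le_mul_of_nonneg_right h4 ha
      nlinarith
    · have := mul_le_mul_of_nonneg_left h2 (hμ0 x)
      have := mul_le_mul_of_nonneg_right h4.le hb
      nlinarith
  have := Finset.sum_le_sum fun x (_ : x ∈ Finset.univ) => h x
  rw [← Finset.sum_mul, ← Finset.mul_sum, ← Finset.mul_sum, Finset.sum_add_distrib,
    Finset.sum_sub_distrib, Finset.sum_add_distrib, hμ, hπ] at this
  unfold tvDist
  refine le_trans (le_of_eq ?_) this
  ring

omit [DecidableEq S] in
theorem sum_mul_norm_sub_sq (w : S → ℝ) (hw : ∑ x, w x = 1) (Φ : S → ℂ) (m : ℂ)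
    (hm : ∑ x, w x • Φ x = m) :
    ∑ x, w x * ‖Φ x - m‖ ^ 2 = ∑ x, w x * ‖Φ x‖ ^ 2 - ‖m‖ ^ 2 := by
  have hre : ∑ x, w x * (Φ x).re = m.re := by simpa using congrArg Complex.re hm
  have him : ∑ x, w x * (Φ x).im = m.im := by simpa using congrArg Complex.im hm
  simp only [Complex.sq_norm, Complex.normSq_apply, Complex.sub_re, Complex.sub_im]
  have : ∀ x, w x * (((Φ x).re - m.re) * ((Φ x).re - m.re) +
      ((Φ x).im - m.im) * ((Φ x).im - m.im)) =
      w x * ((Φ x).re * (Φ x).re + (Φ x).im * (Φ x).im) - 2 * m.re * (w x * (Φ x).re)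
       - 2 * m.im * (w x * (Φ x).im) + (m.re * m.re + m.im * m.im) * w x := by
    intro x; ring
  simp only [this, Finset.sum_add_distrib, Finset.sum_sub_distrib, ← Finset.mul_sum, hre, him, hw]
  ring

/-- Wilson's lower bound method, for an eigenfunction with a complex eigenvalue. -/
theorem norm_pow_mul_le_of_tvDist_le (P : Matrix S S ℝ) (h0 : ∀ x y, 0 ≤ P x y)
    (h1 : ∀ x, ∑ y, P x y = 1) (π : S → ℝ) (hπ0 : ∀ x, 0 ≤ π x) (hπ1 : ∑ x, π x = 1)
    (hπ : Matrix.vecMul π P = π) (Φ : S → ℂ) (lam : ℂ) (hlam : ‖lam‖ < 1)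
    (hΦ : ∀ x, ∑ y, P x y • Φ y = lam * Φ x) (R : ℝ)
    (hR : ∀ x, ∑ y, P x y * ‖Φ y - lam * Φ x‖ ^ 2 ≤ R) (s : S) (t : ℕ)
    (ht : tvDist ((P ^ t) s) π ≤ 1 / 4) :
    ‖lam‖ ^ (2 * t) * ‖Φ s‖ ^ 2 ≤ 6 * (R / (1 - ‖lam‖ ^ 2)) := by
  set V := R / (1 - ‖lam‖ ^ 2) with hV
  have hgap : 0 < 1 - ‖lam‖ ^ 2 := by nlinarith [norm_nonneg lam]
  -- `V` is the fixed point of the second-moment recursion `v ↦ ‖lam‖² v + R`, so it bounds both the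
  -- variance at every time and the stationary second moment.
  have hVR : ‖lam‖ ^ 2 * V + R = V := by rw [hV]; field_simp; ring
  have hstep : ∀ x, ∑ y, P x y * ‖Φ y‖ ^ 2 ≤ ‖lam‖ ^ 2 * ‖Φ x‖ ^ 2 + R := by
    intro x
    have h2 := sum_mul_norm_sub_sq (P x) (h1 x) Φ _ (hΦ x)
    have := hR x
    rw [norm_mul, mul_pow] at h2
    linarith
  have hmean : ∀ t : ℕ, ∑ x, (P ^ t) s x • Φ x = lam ^ t * Φ s := by
    intro t
    induction t with
    | zero => simpa using sum_pow_zero_smul P Φ s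
    | succ t ih =>
      rw [sum_pow_succ_smul]
      simp only [hΦ, ← mul_smul_comm]
      rw [← Finset.mul_sum, ih]
      ring
  have hsecond : ∀ t : ℕ, ∑ x, (P ^ t) s x * ‖Φ x‖ ^ 2 ≤ ‖lam‖ ^ (2 * t) * ‖Φ s‖ ^ 2 + V := by
    intro t
    induction t with
    | zero =>
      have h2 := sum_pow_zero_smul P (fun x => ‖Φ x‖ ^ 2) s
      simp only [smul_eq_mul] at h2
      have : 0 ≤ V := div_nonneg ((Finset.sum_nonneg fun y _ =>
        mul_nonneg (h0 s y) (sq_nonneg _)).trans (hR s)) hgap.le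
      rw [h2]; simpa using this
    | succ t ih =>
      have h2 := sum_pow_succ_smul P (fun x => ‖Φ x‖ ^ 2) t s
      simp only [smul_eq_mul] at h2
      rw [h2]
      calc ∑ y, (P ^ t) s y * ∑ x, P y x * ‖Φ x‖ ^ 2
          ≤ ∑ y, (‖lam‖ ^ 2 * ((P ^ t) s y * ‖Φ y‖ ^ 2) + (P ^ t) s y * R) := by
            refine Finset.sum_le_sum fun y _ => ?_
            have := mul_le_mul_of_nonneg_left (hstep y) (pow_row_nonneg P h0 t s y)
            linarith
        _ = ‖lam‖ ^ 2 * ∑ y, (P ^ t) s y * ‖Φ y‖ ^ 2 + R := by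
            rw [Finset.sum_add_distrib, ← Finset.mul_sum, ← Finset.sum_mul,
              pow_row_sum P h1, one_mul]
        _ ≤ ‖lam‖ ^ 2 * (‖lam‖ ^ (2 * t) * ‖Φ s‖ ^ 2 + V) + R := by gcongr
        _ = _ := by rw [mul_add, add_assoc, hVR]; ring
  have hstat : ∑ x, π x * ‖Φ x‖ ^ 2 ≤ V := by
    have h2 : ∑ x, π x * ‖Φ x‖ ^ 2 = ∑ y, π y * ∑ x, P y x * ‖Φ x‖ ^ 2 := by
      conv_lhs => rw [← hπ]
      simp only [Matrix.vecMul, dotProduct, Finset.sum_mul, Finset.mul_sum, mul_assoc]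
      exact Finset.sum_comm
    have h3 : ∑ y, π y * ∑ x, P y x * ‖Φ x‖ ^ 2 ≤
        ∑ y, (‖lam‖ ^ 2 * (π y * ‖Φ y‖ ^ 2) + π y * R) := by
      refine Finset.sum_le_sum fun y _ => ?_
      have := mul_le_mul_of_nonneg_left (hstep y) (hπ0 y)
      linarith
    rw [Finset.sum_add_distrib, ← Finset.mul_sum, ← Finset.sum_mul, hπ1, ← h2] at h3
    rw [hV, le_div_iff₀ hgap]
    linarith
  have hmu := pow_row_sum P h1 t s
  have h4 := one_sub_tvDist_mul_le ((P ^ t) s) π (pow_row_nonneg P h0 t s) hπ0 hmu hπ1 Φ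
    (lam ^ t * Φ s)
  rw [sum_mul_norm_sub_sq _ hmu Φ _ (hmean t)] at h4
  have h5 : ‖lam ^ t * Φ s‖ ^ 2 = ‖lam‖ ^ (2 * t) * ‖Φ s‖ ^ 2 := by
    rw [norm_mul, norm_pow, mul_pow, ← pow_mul, mul_comm t 2]
  rw [h5] at h4
  have h6 := hsecond t
  have h7 : 0 ≤ ‖lam‖ ^ (2 * t) * ‖Φ s‖ ^ 2 := by positivity
  -- With both terms on the right at most `V`, `(3/4)‖m‖² ≤ 2(V + V)`, and `16/3 ≤ 6`.
  nlinarith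

end Chain

/-! ### One step of the shuffle -/

section MoveToTop

theorem coe_cycleRange {n : ℕ} (j i : Fin n) :
    (Fin.cycleRange j i : ℕ) =
      if (i : ℕ) < j then (i : ℕ) + 1 else if (i : ℕ) = j then 0 else (i : ℕ) := by
  rcases lt_trichotomy i j with h | h | h
  · rw [Fin.coe_cycleRange_of_lt h, if_pos (by exact_mod_cast h)]
  · subst h
    rw [Fin.coe_cycleRange_of_le le_rfl]; simp
  · rw [Fin.cycleRange_of_gt h]
    have : (j : ℕ) < i := h
    rw [if_neg (by omega), if_neg (by omega)]

theorem moveToTop_apply_cycleRange {n : ℕ} (j i : Fin n) (s : Equiv.Perm (Fin n)) :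
    moveToTop j s (Fin.cycleRange j i) = s i := by
  simp [moveToTop]

theorem sum_moveToTopMatrix_smul {n : ℕ} {E : Type*} [AddCommGroup E] [Module ℝ E]
    (p : Fin n → ℝ) (s : Equiv.Perm (Fin n)) (F : Equiv.Perm (Fin n) → E) :
    ∑ s', moveToTopMatrix p s s' • F s' = ∑ j, p j • F (moveToTop j s) := by
  simp only [moveToTopMatrix, Finset.sum_smul]
  rw [Finset.sum_comm]
  refine Finset.sum_congr rfl fun j _ => ?_
  simp [ite_smul]

theorem bottomWeight_nonneg (n k : ℕ) (j : Fin n) : 0 ≤ bottomWeight n k j := by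
  unfold bottomWeight; split_ifs <;> positivity

theorem bottomWeight_le (n k : ℕ) (j : Fin n) : bottomWeight n k j ≤ 1 / k := by
  unfold bottomWeight; split_ifs
  · exact le_rfl
  · positivity

theorem bottomToTopMatrix_nonneg (n k : ℕ) (s s' : Equiv.Perm (Fin n)) :
    0 ≤ bottomToTopMatrix n k s s' := by
  unfold bottomToTopMatrix moveToTopMatrix
  refine Finset.sum_nonneg fun j _ => ?_
  split_ifs
  · exact bottomWeight_nonneg n k j
  · exact le_rfl

theorem uniformDeck_nonneg (n : ℕ) (s : Equiv.Perm (Fin n)) : 0 ≤ uniformDeck n s := by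
  unfold uniformDeck; positivity

theorem uniformDeck_sum (n : ℕ) : ∑ s, uniformDeck n s = 1 := by
  have : (Nat.factorial n : ℝ) ≠ 0 := by positivity
  simp [uniformDeck, Fintype.card_perm, this]

end MoveToTop

/-! ### The increasing run at the bottom: a lower bound of order `k log n` -/

section SortedSuffix

/-- The cards in the bottom `m` positions are in increasing order. -/
def SuffixSorted {n : ℕ} (s : Equiv.Perm (Fin n)) (m : ℕ) : Prop :=
  ∀ i i' : Fin n, n ≤ (i : ℕ) + m → i < i' → s i < s i'

/-- Removing one card from the sorted block leaves the others in order, filling the bottom `m - 1`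
positions. -/
theorem SuffixSorted.moveToTop {n m : ℕ} {s : Equiv.Perm (Fin n)} (h : SuffixSorted s m)
    (hm : m ≤ n) (j : Fin n) : SuffixSorted (moveToTop j s) (m - 1) := by
  intro i i' hi hii'
  obtain ⟨a, rfl⟩ := (Fin.cycleRange j).surjective i
  obtain ⟨b, rfl⟩ := (Fin.cycleRange j).surjective i'
  rw [moveToTop_apply_cycleRange, moveToTop_apply_cycleRange]
  rw [Fin.lt_def, coe_cycleRange, coe_cycleRange] at hii'
  rw [coe_cycleRange] at hi
  have := a.2
  have := b.2
  refine h a b ?_ ?_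
  · split_ifs at hi <;> omega
  · rw [Fin.lt_def]
    split_ifs at hi hii' <;> omega

theorem SuffixSorted.moveToTop_of_lt {n m : ℕ} {s : Equiv.Perm (Fin n)} (h : SuffixSorted s m)
    (j : Fin n) (hj : (j : ℕ) + m < n) : SuffixSorted (_root_.moveToTop j s) m := by
  intro i i' hi hii'
  obtain ⟨a, rfl⟩ := (Fin.cycleRange j).surjective i
  obtain ⟨b, rfl⟩ := (Fin.cycleRange j).surjective i'
  rw [moveToTop_apply_cycleRange, moveToTop_apply_cycleRange]
  rw [Fin.lt_def, coe_cycleRange, coe_cycleRange] at hii'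
  rw [coe_cycleRange] at hi
  have := a.2
  have := b.2
  refine h a b ?_ ?_
  · split_ifs at hi <;> omega
  · rw [Fin.lt_def]
    split_ifs at hi hii' <;> omega

open Classical in
/-- The length, at most `n`, of the longest increasing run of cards at the bottom of the deck. -/
noncomputable def sortedSuffix {n : ℕ} (s : Equiv.Perm (Fin n)) : ℕ :=
  Nat.findGreatest (SuffixSorted s) n

theorem suffixSorted_zero {n : ℕ} (s : Equiv.Perm (Fin n)) : SuffixSorted s 0 := by
  intro i i' hi
  have := i.2
  omega

theorem sortedSuffix_le {n : ℕ} (s : Equiv.Perm (Fin n)) : sortedSuffix s ≤ n := by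
  classical exact Nat.findGreatest_le n

theorem suffixSorted_sortedSuffix {n : ℕ} (s : Equiv.Perm (Fin n)) :
    SuffixSorted s (sortedSuffix s) := by
  classical exact Nat.findGreatest_spec (Nat.zero_le n) (suffixSorted_zero s)

theorem SuffixSorted.le_sortedSuffix {n m : ℕ} {s : Equiv.Perm (Fin n)} (h : SuffixSorted s m)
    (hm : m ≤ n) : m ≤ sortedSuffix s := by
  classical exact Nat.le_findGreatest hm h

theorem sortedSuffix_one (n : ℕ) : sortedSuffix (1 : Equiv.Perm (Fin n)) = n :=
  le_antisymm (sortedSuffix_le _)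
    (SuffixSorted.le_sortedSuffix (fun _ _ _ h => by simpa using h) le_rfl)

/-- If the moved card lies in the run of length `u`, the run keeps length at least `u - 1`, and `1/u
= (1 + 1/u) * (1/(u+1))`. The factor `1/u` on the `u` bottom positions is exactly `bottomWeight n
u`, whose total mass is at most `1`; this makes the averaged bound independent of `u`. -/
theorem one_div_sortedSuffix_moveToTop_le {n : ℕ} (s : Equiv.Perm (Fin n)) (j : Fin n) :
    1 / ((sortedSuffix (moveToTop j s) : ℝ) + 1) ≤ 1 / ((sortedSuffix s : ℝ) + 1) +
      bottomWeight n (sortedSuffix s) j * (1 / ((sortedSuffix s : ℝ) + 1)) := by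
  have hs := suffixSorted_sortedSuffix s
  have hn := sortedSuffix_le s
  have hj := j.2
  set u := sortedSuffix s
  unfold bottomWeight
  split_ifs with h
  · have hu : 1 ≤ u := by omega
    have h1 : u - 1 ≤ sortedSuffix (moveToTop j s) := (hs.moveToTop hn j).le_sortedSuffix (by omega)
    have h2 : (u : ℝ) ≤ (sortedSuffix (moveToTop j s) : ℝ) + 1 := by exact_mod_cast (by omega)
    have hu' : (0 : ℝ) < u := by exact_mod_cast hu
    calc 1 / ((sortedSuffix (moveToTop j s) : ℝ) + 1) ≤ 1 / u := by gcongr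
      _ = _ := by field_simp
  · have h1 : u ≤ sortedSuffix (moveToTop j s) :=
      (hs.moveToTop_of_lt j (by omega)).le_sortedSuffix hn
    have h2 : (u : ℝ) ≤ (sortedSuffix (moveToTop j s) : ℝ) := by exact_mod_cast h1
    rw [zero_mul, add_zero]
    gcongr

theorem sum_bottomToTopMatrix_one_div_sortedSuffix_le {n k : ℕ} (hk : 0 < k) (hkn : k ≤ n)
    (s : Equiv.Perm (Fin n)) :
    ∑ s', bottomToTopMatrix n k s s' * (1 / ((sortedSuffix s' : ℝ) + 1)) ≤
      (1 + 1 / k) * (1 / ((sortedSuffix s : ℝ) + 1)) := by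
  have h := sum_moveToTopMatrix_smul (bottomWeight n k) s
    (fun s' => 1 / ((sortedSuffix s' : ℝ) + 1))
  simp only [smul_eq_mul] at h
  unfold bottomToTopMatrix
  rw [h]
  have hsum : ∑ j, bottomWeight n (sortedSuffix s) j ≤ 1 := by
    rcases Nat.eq_zero_or_pos (sortedSuffix s) with h0 | h0
    · simp [h0, bottomWeight]
    · exact (bottomWeight_sum n _ h0 (sortedSuffix_le s)).le
  set q : ℝ := 1 / ((sortedSuffix s : ℝ) + 1) with hq
  have hq0 : 0 ≤ q := by positivity
  calc ∑ j, bottomWeight n k j * (1 / ((sortedSuffix (moveToTop j s) : ℝ) + 1))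
      ≤ ∑ j, (bottomWeight n k j * q + (1 / k * q) * bottomWeight n (sortedSuffix s) j) := by
        refine Finset.sum_le_sum fun j _ => ?_
        have h1 := mul_le_mul_of_nonneg_left (one_div_sortedSuffix_moveToTop_le s j)
          (bottomWeight_nonneg n k j)
        have h2 := mul_le_mul_of_nonneg_right (bottomWeight_le n k j)
          (mul_nonneg (bottomWeight_nonneg n (sortedSuffix s) j) hq0)
        linarith
    _ = q + (1 / k * q) * ∑ j, bottomWeight n (sortedSuffix s) j := by
        rw [Finset.sum_add_distrib, ← Finset.sum_mul, ← Finset.mul_sum,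
          bottomWeight_sum n k hk hkn, one_mul]
    _ ≤ q + (1 / k * q) * 1 := by gcongr
    _ = _ := by ring

/-- Exchanging the cards at the two positions preserves the uniform law and complements the event.
-/
theorem sum_uniformDeck_indicator_not_lt {n : ℕ} (i i' : Fin n) (h : i ≠ i') :
    ∑ s, uniformDeck n s * (if s i < s i' then 0 else 1) = 1 / 2 := by
  have h1 : ∑ s, uniformDeck n s * (if s i < s i' then (0 : ℝ) else 1) =
      ∑ s, uniformDeck n s * (if s i < s i' then 1 else 0) := by
    refine Fintype.sum_equiv (Equiv.mulRight (Equiv.swap i i')) _ _ fun s => ?_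
    have hne : s i ≠ s i' := fun h' => h (s.injective h')
    simp only [uniformDeck, Equiv.coe_mulRight, Equiv.Perm.mul_apply, Equiv.swap_apply_left,
      Equiv.swap_apply_right]
    rcases lt_or_gt_of_ne hne with h2 | h2
    · rw [if_pos h2, if_neg h2.not_gt]
    · rw [if_neg h2.not_gt, if_pos h2]
  have h2 : ∑ s, uniformDeck n s * (if s i < s i' then (0 : ℝ) else 1) +
      ∑ s, uniformDeck n s * (if s i < s i' then 1 else 0) = 1 := by
    rw [← Finset.sum_add_distrib]
    refine Eq.trans (Finset.sum_congr rfl fun s _ => ?_) (uniformDeck_sum n)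
    split_ifs <;> simp
  linarith

/-- The test event is that the bottom two cards are inverted: its stationary probability is `1/2`,
hence at least `1/4` at time `t`. It forces the run to have length at most `1`, so Markov's
inequality bounds its probability by `2(1 + 1/k)^t / (n + 1)`. -/
theorem le_one_add_one_div_pow_of_tvDist_le {n k t : ℕ} (hk : 2 ≤ k) (hkn : k ≤ n)
    (ht : tvDist ((bottomToTopMatrix n k ^ t) 1) (uniformDeck n) ≤ 1 / 4) :
    ((n : ℝ) + 1) / 8 ≤ (1 + 1 / (k : ℝ)) ^ t := by
  have h0 := bottomToTopMatrix_nonneg n k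
  have h1 := bottomToTopMatrix_row_sum n k (by omega) hkn
  have hμ := pow_row_sum _ h1 t 1
  set i : Fin n := ⟨n - 2, by omega⟩
  set i' : Fin n := ⟨n - 1, by omega⟩
  have hii' : i < i' := by rw [Fin.lt_def]; simp only [i, i']; omega
  have h2 := sum_le_sum_add_tvDist _ _ hμ (uniformDeck_sum n)
    (fun s : Equiv.Perm (Fin n) => if s i < s i' then 0 else 1)
    (fun s => by split_ifs <;> norm_num) (fun s => by split_ifs <;> norm_num)
  rw [sum_uniformDeck_indicator_not_lt i i' hii'.ne] at h2
  have h3 := sum_pow_le_of_superharmonic _ h0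
    (fun s : Equiv.Perm (Fin n) => 1 / ((sortedSuffix s : ℝ) + 1)) (1 + 1 / k) (by positivity)
    (sum_bottomToTopMatrix_one_div_sortedSuffix_le (by omega) hkn) t 1
  rw [sortedSuffix_one] at h3
  have h4 : ∑ s, (bottomToTopMatrix n k ^ t) 1 s * (if s i < s i' then (0 : ℝ) else 1) ≤
      ∑ s, 2 * ((bottomToTopMatrix n k ^ t) 1 s * (1 / ((sortedSuffix s : ℝ) + 1))) := by
    refine Finset.sum_le_sum fun s _ => ?_
    have h5 : (if s i < s i' then (0 : ℝ) else 1) ≤ 2 * (1 / ((sortedSuffix s : ℝ) + 1)) := by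
      split_ifs with h
      · positivity
      · have h6 : sortedSuffix s ≤ 1 := by
          by_contra h7
          refine h (suffixSorted_sortedSuffix s i i' ?_ hii')
          simp only [i]; omega
        have h7 : (sortedSuffix s : ℝ) ≤ 1 := by exact_mod_cast h6
        rw [mul_one_div, le_div_iff₀ (by positivity)]
        linarith
    have := mul_le_mul_of_nonneg_left h5 (pow_row_nonneg _ h0 t 1 s)
    linarith
  rw [← Finset.mul_sum] at h4
  have h8 : 1 / 8 ≤ (1 + 1 / (k : ℝ)) ^ t * (1 / ((n : ℝ) + 1)) := by linarith
  rw [mul_one_div, div_le_div_iff₀ (by norm_num) (by positivity)] at h8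
  linarith

theorem mul_log_le_of_tvDist_le {n k t : ℕ} (hk : 2 ≤ k) (hkn : k ≤ n)
    (ht : tvDist ((bottomToTopMatrix n k ^ t) 1) (uniformDeck n) ≤ 1 / 4) :
    k * Real.log (((n : ℝ) + 1) / 8) ≤ t := by
  have h := le_one_add_one_div_pow_of_tvDist_le hk hkn ht
  have hk0 : (0 : ℝ) < k := by exact_mod_cast (by omega)
  have h1 : (1 + 1 / (k : ℝ)) ^ t ≤ Real.exp (t / k) := by
    rw [div_eq_mul_one_div (t : ℝ), Real.exp_nat_mul]
    gcongr
    rw [add_comm]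
    exact Real.add_one_le_exp _
  have h2 := (Real.log_le_iff_le_exp (by positivity)).2 (h.trans h1)
  rw [le_div_iff₀ hk0] at h2
  linarith

end SortedSuffix

/-! ### The eigenfunction built from single-card motions -/

section CardFunction

/-- The eigenfunction of the motion of a single card, as a function of the card's position. -/
noncomputable def cardFunction (n k : ℕ) (lam : ℂ) (i : Fin n) : ℂ :=
  lam ^ min (i : ℕ) (n - k)

/-- The weighted sum of the single card eigenfunctions. -/
noncomputable def deckFunction (n k : ℕ) (lam : ℂ) (a : Fin n → ℂ) (s : Equiv.Perm (Fin n)) : ℂ :=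
  ∑ i, a (s i) * cardFunction n k lam i

theorem cardFunction_cycleRange_of_lt {n k : ℕ} (lam : ℂ) {i j : Fin n}
    (hi : (i : ℕ) < n - k) (hj : n ≤ (j : ℕ) + k) :
    cardFunction n k lam (Fin.cycleRange j i) = lam * cardFunction n k lam i := by
  unfold cardFunction
  rw [coe_cycleRange, if_pos (by omega), min_eq_left (by omega), min_eq_left (by omega), pow_succ']

theorem cardFunction_of_le {n k : ℕ} (lam : ℂ) {i : Fin n} (hi : n - k ≤ (i : ℕ)) :
    cardFunction n k lam i = lam ^ (n - k) := by
  unfold cardFunction; rw [min_eq_right hi]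

theorem cardFunction_cycleRange_of_le {n k : ℕ} (lam : ℂ) {i j : Fin n}
    (hi : n - k ≤ (i : ℕ)) :
    cardFunction n k lam (Fin.cycleRange j i) = if j = i then 1 else lam ^ (n - k) := by
  unfold cardFunction
  rw [coe_cycleRange]
  by_cases h : j = i
  · subst h; simp
  · have : (i : ℕ) ≠ j := fun h' => h (Fin.ext h'.symm)
    rw [if_neg h]
    split_ifs
    · rw [min_eq_right (by omega)]
    · rw [min_eq_right (by omega)]

/-- Above the bottom block a card always moves down one place, which multiplies the function by
`lam`. On the block, where it is constant equal to `g = lam ^ (n - k)`, the equation reads `(1/k) +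
(1 - 1/k) g = lam g`, which is `hlam`. -/
theorem sum_bottomWeight_smul_cardFunction {n k : ℕ} (hk : 0 < k) (hkn : k ≤ n) {lam : ℂ}
    (hlam : lam ^ (n - k) * (1 + k * (lam - 1)) = 1) (i : Fin n) :
    ∑ j, bottomWeight n k j • cardFunction n k lam (Fin.cycleRange j i) =
      lam * cardFunction n k lam i := by
  have hsum : ∑ j, ((bottomWeight n k j : ℝ) : ℂ) = 1 := by
    rw [← Complex.ofReal_sum, bottomWeight_sum n k hk hkn, Complex.ofReal_one]
  rcases lt_or_ge (i : ℕ) (n - k) with hi | hi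
  · calc _ = ∑ j, ((bottomWeight n k j : ℝ) : ℂ) * (lam * cardFunction n k lam i) := by
          refine Finset.sum_congr rfl fun j _ => ?_
          by_cases hj : n ≤ (j : ℕ) + k
          · rw [cardFunction_cycleRange_of_lt lam hi hj, Complex.real_smul]
          · simp [bottomWeight, hj]
      _ = _ := by rw [← Finset.sum_mul, hsum, one_mul]
  · rw [cardFunction_of_le lam hi]
    have h1 : ∀ j, bottomWeight n k j • cardFunction n k lam (Fin.cycleRange j i) =
        ((bottomWeight n k j : ℝ) : ℂ) * lam ^ (n - k) +
        if j = i then (1 / k : ℂ) * (1 - lam ^ (n - k)) else 0 := by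
      intro j
      rw [cardFunction_cycleRange_of_le lam hi, Complex.real_smul]
      split_ifs with h
      · subst h
        have : bottomWeight n k j = 1 / k := by rw [bottomWeight, if_pos (by omega)]
        rw [this]; push_cast; ring
      · ring
    rw [Finset.sum_congr rfl fun j _ => h1 j, Finset.sum_add_distrib, ← Finset.sum_mul, hsum]
    have hk0 : (k : ℂ) ≠ 0 := by exact_mod_cast hk.ne'
    simp only [Finset.sum_ite_eq', Finset.mem_univ, if_true]
    field_simp
    linear_combination -hlam

theorem deckFunction_moveToTop {n : ℕ} (k : ℕ) (lam : ℂ) (a : Fin n → ℂ) (j : Fin n)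
    (s : Equiv.Perm (Fin n)) :
    deckFunction n k lam a (moveToTop j s) =
      ∑ i, a (s i) * cardFunction n k lam (Fin.cycleRange j i) := by
  unfold deckFunction
  rw [← Equiv.sum_comp (Fin.cycleRange j)]
  simp only [moveToTop_apply_cycleRange]

theorem sum_bottomToTopMatrix_smul_deckFunction {n k : ℕ} (hk : 0 < k) (hkn : k ≤ n) {lam : ℂ}
    (hlam : lam ^ (n - k) * (1 + k * (lam - 1)) = 1) (a : Fin n → ℂ) (s : Equiv.Perm (Fin n)) :
    ∑ s', bottomToTopMatrix n k s s' • deckFunction n k lam a s' =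
      lam * deckFunction n k lam a s := by
  unfold bottomToTopMatrix
  rw [sum_moveToTopMatrix_smul]
  simp only [deckFunction_moveToTop, Finset.smul_sum]
  rw [Finset.sum_comm]
  simp only [← mul_smul_comm, ← Finset.mul_sum,
    sum_bottomWeight_smul_cardFunction hk hkn hlam]
  unfold deckFunction
  rw [Finset.mul_sum]
  exact Finset.sum_congr rfl fun i _ => by ring

/-- Only the `k` cards of the bottom block contribute. Each gives at most `‖1 - lam‖`, and the moved
one gives a further `‖1 - g‖ ≤ k ‖1 - lam‖`, by the eigenvalue equation. -/
theorem norm_deckFunction_moveToTop_sub_le {n k : ℕ} (hk : 0 < k) (hkn : k ≤ n) {lam : ℂ}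
    (hlam1 : ‖lam‖ ≤ 1) (hlam : lam ^ (n - k) * (1 + k * (lam - 1)) = 1) (a : Fin n → ℂ)
    (ha : ∀ i, ‖a i‖ ≤ 1) (s : Equiv.Perm (Fin n)) {j : Fin n} (hj : n ≤ (j : ℕ) + k) :
    ‖deckFunction n k lam a (moveToTop j s) - lam * deckFunction n k lam a s‖ ≤
      2 * k * ‖1 - lam‖ := by
  rw [deckFunction_moveToTop, deckFunction, Finset.mul_sum, ← Finset.sum_sub_distrib]
  set g := lam ^ (n - k) with hg
  have hg1 : ‖g‖ ≤ 1 := by rw [hg, norm_pow]; exact pow_le_one₀ (norm_nonneg _) hlam1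
  have hg2 : ‖1 - g‖ ≤ k * ‖1 - lam‖ := by
    have : 1 - g = -(g * (k * (1 - lam))) := by linear_combination -hlam
    rw [this, norm_neg, norm_mul, norm_mul, Complex.norm_natCast]
    exact mul_le_of_le_one_left (by positivity) hg1
  have hterm : ∀ i, ‖a (s i) * cardFunction n k lam (Fin.cycleRange j i) -
      lam * (a (s i) * cardFunction n k lam i)‖ ≤
      bottomWeight n k i * (k * ‖1 - lam‖) + if j = i then k * ‖1 - lam‖ else 0 := by
    intro i
    have h1 : a (s i) * cardFunction n k lam (Fin.cycleRange j i) -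
        lam * (a (s i) * cardFunction n k lam i) = a (s i) *
          (cardFunction n k lam (Fin.cycleRange j i) - lam * cardFunction n k lam i) := by ring
    rw [h1, norm_mul]
    refine (mul_le_of_le_one_left (norm_nonneg _) (ha _)).trans ?_
    rcases lt_or_ge (i : ℕ) (n - k) with hi | hi
    · rw [cardFunction_cycleRange_of_lt lam hi hj, sub_self, norm_zero]
      have := bottomWeight_nonneg n k i
      split_ifs <;> positivity
    · have hb : bottomWeight n k i = 1 / k := by rw [bottomWeight, if_pos (by omega)]
      rw [cardFunction_of_le lam hi, cardFunction_cycleRange_of_le lam hi, ← hg, hb]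
      have hk0 : (0 : ℝ) < k := by exact_mod_cast hk
      have h2 : 1 / (k : ℝ) * (k * ‖1 - lam‖) = ‖1 - lam‖ := by field_simp
      have h3 : ‖g - lam * g‖ ≤ ‖1 - lam‖ := by
        rw [show g - lam * g = g * (1 - lam) by ring, norm_mul]
        exact mul_le_of_le_one_left (norm_nonneg _) hg1
      rw [h2]
      split_ifs
      · calc ‖1 - lam * g‖ = ‖(g - lam * g) + (1 - g)‖ := by congr 1; ring
          _ ≤ _ := norm_add_le _ _
          _ ≤ _ := add_le_add h3 hg2
      · rw [add_zero]; exact h3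
  refine (norm_sum_le _ _).trans ((Finset.sum_le_sum fun i _ => hterm i).trans (le_of_eq ?_))
  rw [Finset.sum_add_distrib, ← Finset.sum_mul, bottomWeight_sum n k hk hkn]
  simp only [Finset.sum_ite_eq, Finset.mem_univ, if_true]
  ring

theorem norm_pow_mul_deckFunction_le {n k : ℕ} (hk : 0 < k) (hkn : k ≤ n) {lam : ℂ}
    (hlam1 : ‖lam‖ < 1) (hlam : lam ^ (n - k) * (1 + k * (lam - 1)) = 1) {t : ℕ}
    (ht : tvDist ((bottomToTopMatrix n k ^ t) 1) (uniformDeck n) ≤ 1 / 4) :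
    ‖lam‖ ^ (2 * t) * (n * ‖lam‖ ^ (2 * n)) ^ 2 ≤
      6 * ((2 * k * ‖1 - lam‖) ^ 2 / (1 - ‖lam‖ ^ 2)) := by
  -- Conjugate weights make every term of the sum at the ordered deck nonnegative, so no
  -- cancellation occurs there.
  set a : Fin n → ℂ := fun i => (starRingEnd ℂ) (cardFunction n k lam i) with ha
  have hnorm : ∀ i, ‖cardFunction n k lam i‖ ≤ 1 := fun i => by
    rw [cardFunction, norm_pow]; exact pow_le_one₀ (norm_nonneg _) hlam1.le
  have ha1 : ∀ i, ‖a i‖ ≤ 1 := fun i => by rw [ha, RCLike.norm_conj]; exact hnorm i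
  have hw := norm_pow_mul_le_of_tvDist_le _ (bottomToTopMatrix_nonneg n k)
    (bottomToTopMatrix_row_sum n k hk hkn) _ (uniformDeck_nonneg n) (uniformDeck_sum n)
    (uniformDeck_stationary n k hk hkn) (deckFunction n k lam a) lam hlam1
    (sum_bottomToTopMatrix_smul_deckFunction hk hkn hlam a) ((2 * k * ‖1 - lam‖) ^ 2)
    (fun s => ?_) 1 t ht
  · refine le_trans ?_ hw
    have hsum : deckFunction n k lam a 1 = ((∑ i, ‖cardFunction n k lam i‖ ^ 2 : ℝ) : ℂ) := by
      simp [deckFunction, ha, Complex.conj_mul']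
    have hge : n * ‖lam‖ ^ (2 * n) ≤ ∑ i, ‖cardFunction n k lam i‖ ^ 2 := by
      calc (n : ℝ) * ‖lam‖ ^ (2 * n) = ∑ _i : Fin n, ‖lam‖ ^ (2 * n) := by simp
        _ ≤ _ := by
          refine Finset.sum_le_sum fun i _ => ?_
          rw [cardFunction, norm_pow, ← pow_mul]
          have := i.2
          exact pow_le_pow_of_le_one (norm_nonneg _) hlam1.le (by omega)
    rw [hsum, Complex.norm_real, Real.norm_of_nonneg (Finset.sum_nonneg fun _ _ => sq_nonneg _)]
    gcongr
  · have h := sum_moveToTopMatrix_smul (bottomWeight n k) s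
      (fun s' => ‖deckFunction n k lam a s' - lam * deckFunction n k lam a s‖ ^ 2)
    simp only [smul_eq_mul] at h
    unfold bottomToTopMatrix
    rw [h]
    calc _ ≤ ∑ j, bottomWeight n k j * (2 * k * ‖1 - lam‖) ^ 2 := by
          refine Finset.sum_le_sum fun j _ => ?_
          by_cases hj : n ≤ (j : ℕ) + k
          · gcongr
            · exact bottomWeight_nonneg n k j
            · exact norm_deckFunction_moveToTop_sub_le hk hkn hlam1.le hlam a ha1 s hj
          · simp [bottomWeight, hj]
      _ = _ := by rw [← Finset.sum_mul, bottomWeight_sum n k hk hkn, one_mul]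

end CardFunction

/-! ### Location of the eigenvalue near `exp (2πi/n)` -/

/-- The logarithm of `1 + k (exp z - 1)` with its linear part removed. -/
noncomputable def logExcess (k : ℝ) (z : ℂ) : ℂ :=
  Complex.log (1 + k * (Complex.exp z - 1)) - k * z

theorem norm_exp_sub_one_le_two {z : ℂ} (hz : ‖z‖ ≤ 1) : ‖Complex.exp z - 1‖ ≤ 2 * ‖z‖ :=
  Complex.norm_exp_sub_one_le hz

theorem half_le_norm_one_add {k : ℝ} (hk : 1 ≤ k) {z : ℂ} (hz : k * ‖z‖ ≤ 1 / 4) :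
    ‖(k : ℂ) * (Complex.exp z - 1)‖ ≤ 1 / 2 ∧
      1 / 2 ≤ ‖1 + (k : ℂ) * (Complex.exp z - 1)‖ := by
  have hz1 : ‖z‖ ≤ 1 := by nlinarith [norm_nonneg z]
  have h1 : ‖(k : ℂ) * (Complex.exp z - 1)‖ ≤ 1 / 2 := by
    rw [norm_mul, Complex.norm_real, Real.norm_of_nonneg (by linarith)]
    nlinarith [norm_exp_sub_one_le_two hz1]
  refine ⟨h1, ?_⟩
  have := norm_sub_le_norm_add (1 : ℂ) ((k : ℂ) * (Complex.exp z - 1))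
  rw [norm_one] at this
  linarith

theorem hasDerivAt_logExcess {k : ℝ} (hk : 1 ≤ k) {z : ℂ} (hz : k * ‖z‖ ≤ 1 / 4) :
    HasDerivAt (logExcess k)
      (-(k * (k - 1) * (Complex.exp z - 1)) / (1 + k * (Complex.exp z - 1))) z := by
  obtain ⟨h1, h2⟩ := half_le_norm_one_add hk hz
  have hslit : 1 + (k : ℂ) * (Complex.exp z - 1) ∈ Complex.slitPlane :=
    Complex.mem_slitPlane_of_norm_lt_one (lt_of_le_of_lt h1 (by norm_num))
  have hne : 1 + (k : ℂ) * (Complex.exp z - 1) ≠ 0 := Complex.slitPlane_ne_zero hslit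
  have h3 : HasDerivAt (fun z : ℂ => 1 + (k : ℂ) * (Complex.exp z - 1)) (k * Complex.exp z) z :=
    (((Complex.hasDerivAt_exp z).sub_const 1).const_mul (k : ℂ)).const_add 1
  have h4 := (h3.clog hslit).sub ((hasDerivAt_id z).const_mul (k : ℂ))
  refine h4.congr_deriv ?_
  field_simp
  ring

theorem norm_deriv_logExcess_le {k : ℝ} (hk : 1 ≤ k) {z : ℂ} (hz : k * ‖z‖ ≤ 1 / 4) :
    ‖-(k * (k - 1) * (Complex.exp z - 1)) / (1 + k * (Complex.exp z - 1))‖ ≤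
      4 * k ^ 2 * ‖z‖ := by
  obtain ⟨h1, h2⟩ := half_le_norm_one_add hk hz
  have hz1 : ‖z‖ ≤ 1 := by nlinarith [norm_nonneg z]
  rw [norm_div, norm_neg, norm_mul, div_le_iff₀ (by linarith)]
  have h3 : ‖(k : ℂ) * (k - 1)‖ ≤ k ^ 2 := by
    rw [show (k : ℂ) * (k - 1) = ((k * (k - 1) : ℝ) : ℂ) by push_cast; ring, Complex.norm_real,
      Real.norm_of_nonneg (by nlinarith)]
    nlinarith
  calc ‖(k : ℂ) * (k - 1)‖ * ‖Complex.exp z - 1‖ ≤ k ^ 2 * (2 * ‖z‖) := by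
        gcongr; exact norm_exp_sub_one_le_two hz1
    _ = 4 * k ^ 2 * ‖z‖ * (1 / 2) := by ring
    _ ≤ _ := by gcongr

/-- The quadratic part of `logExcess k` is `-k(k-1)z²/2`; this compares derivatives, so that the
mean value inequality gives the cubic remainder of `norm_logExcess_add_le`. -/
theorem norm_deriv_logExcess_add_le {k : ℝ} (hk : 1 ≤ k) {z : ℂ} (hz : k * ‖z‖ ≤ 1 / 4) :
    ‖-(k * (k - 1) * (Complex.exp z - 1)) / (1 + k * (Complex.exp z - 1)) + k * (k - 1) * z‖ ≤
      6 * k ^ 3 * ‖z‖ ^ 2 := by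
  obtain ⟨h1, h2⟩ := half_le_norm_one_add hk hz
  have hz1 : ‖z‖ ≤ 1 := by nlinarith [norm_nonneg z]
  have hne : 1 + (k : ℂ) * (Complex.exp z - 1) ≠ 0 := by
    intro h; rw [h, norm_zero] at h2; norm_num at h2
  have h3 : ‖(k : ℂ) * (k - 1)‖ ≤ k ^ 2 := by
    rw [show (k : ℂ) * (k - 1) = ((k * (k - 1) : ℝ) : ℂ) by push_cast; ring, Complex.norm_real,
      Real.norm_of_nonneg (by nlinarith)]
    nlinarith
  have h4 : -(k * (k - 1) * (Complex.exp z - 1)) / (1 + k * (Complex.exp z - 1)) + k * (k - 1) * z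
      = (k * (k - 1) * (z * (k * (Complex.exp z - 1)) - (Complex.exp z - 1 - z))) /
        (1 + k * (Complex.exp z - 1)) := by
    field_simp; ring
  rw [h4, norm_div, norm_mul, div_le_iff₀ (by linarith)]
  have h5 : ‖z * (k * (Complex.exp z - 1)) - (Complex.exp z - 1 - z)‖ ≤ 3 * k * ‖z‖ ^ 2 := by
    calc _ ≤ ‖z * (k * (Complex.exp z - 1))‖ + ‖Complex.exp z - 1 - z‖ := norm_sub_le _ _
      _ ≤ ‖z‖ * (k * (2 * ‖z‖)) + ‖z‖ ^ 2 := by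
        rw [norm_mul, norm_mul, Complex.norm_real, Real.norm_of_nonneg (by linarith : 0 ≤ k)]
        gcongr
        · exact norm_exp_sub_one_le_two hz1
        · exact Complex.norm_exp_sub_one_sub_id_le hz1
      _ ≤ _ := by nlinarith [sq_nonneg ‖z‖]
  calc ‖(k : ℂ) * (k - 1)‖ * ‖z * (k * (Complex.exp z - 1)) - (Complex.exp z - 1 - z)‖
      ≤ k ^ 2 * (3 * k * ‖z‖ ^ 2) := by gcongr
    _ = 6 * k ^ 3 * ‖z‖ ^ 2 * (1 / 2) := by ring
    _ ≤ _ := by gcongr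

theorem norm_logExcess_sub_le {k r : ℝ} (hk : 1 ≤ k) (hr : k * r ≤ 1 / 4) {x y : ℂ}
    (hx : ‖x‖ ≤ r) (hy : ‖y‖ ≤ r) :
    ‖logExcess k y - logExcess k x‖ ≤ 4 * k ^ 2 * r * ‖y - x‖ := by
  refine (convex_closedBall (0 : ℂ) r).norm_image_sub_le_of_norm_hasDerivWithin_le
    (f' := fun z => -(k * (k - 1) * (Complex.exp z - 1)) / (1 + k * (Complex.exp z - 1)))
    (fun z hz => ?_) (fun z hz => ?_) (by simpa using hx) (by simpa using hy)
  all_goals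
    have hz : ‖z‖ ≤ r := by simpa using hz
    have hz' : k * ‖z‖ ≤ 1 / 4 := le_trans (by gcongr) hr
  · exact (hasDerivAt_logExcess hk hz').hasDerivWithinAt
  · exact (norm_deriv_logExcess_le hk hz').trans (by gcongr)

theorem logExcess_zero (k : ℝ) : logExcess k 0 = 0 := by simp [logExcess]

theorem norm_logExcess_add_le {k : ℝ} (hk : 1 ≤ k) {z : ℂ} (hz : k * ‖z‖ ≤ 1 / 4) :
    ‖logExcess k z + k * (k - 1) * z ^ 2 / 2‖ ≤ 6 * k ^ 3 * ‖z‖ ^ 3 := by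
  have h := (convex_closedBall (0 : ℂ) ‖z‖).norm_image_sub_le_of_norm_hasDerivWithin_le
    (f := fun z => logExcess k z + k * (k - 1) * z ^ 2 / 2)
    (f' := fun z => -(k * (k - 1) * (Complex.exp z - 1)) / (1 + k * (Complex.exp z - 1))
      + k * (k - 1) * z) (C := 6 * k ^ 3 * ‖z‖ ^ 2) (x := 0) (y := z)
    (fun y hy => ?_) (fun y hy => ?_) (by simp) (by simp)
  · simpa [logExcess_zero, pow_succ, mul_assoc] using h
  all_goals
    have hy : ‖y‖ ≤ ‖z‖ := by simpa using hy
    have hy' : k * ‖y‖ ≤ 1 / 4 := le_trans (by gcongr) hz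
  · refine HasDerivAt.hasDerivWithinAt ?_
    refine (hasDerivAt_logExcess hk hy').add ?_
    have := (((hasDerivAt_id y).pow 2).const_mul ((k : ℂ) * (k - 1))).div_const 2
    refine this.congr_deriv ?_
    simp; ring
  · exact (norm_deriv_logExcess_add_le hk hy').trans (by gcongr)

/-- Banach's fixed point theorem for `z ↦ (2πi - logExcess k z) / n`. The radius `7 / n` leaves room
above `2π / n` for the small term `logExcess k z`. -/
theorem exists_eq_two_pi_I_sub_logExcess {k n : ℝ} (hk : 1 ≤ k) (hkn : 100 * k ≤ n) :
    ∃ z : ℂ, ‖z‖ ≤ 7 / n ∧ n * z = 2 * Real.pi * Complex.I - logExcess k z := by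
  have hn : 0 < n := by linarith
  have hkr : k * (7 / n) ≤ 7 / 100 := by
    rw [mul_div_assoc', div_le_div_iff₀ hn (by norm_num)]; linarith
  have hr : k * (7 / n) ≤ 1 / 4 := by linarith
  have hlip : 4 * k ^ 2 * (7 / n) / n ≤ 1 / 2 := by
    have : 4 * k ^ 2 * (7 / n) / n = 4 / 7 * (k * (7 / n)) ^ 2 := by field_simp
    rw [this]
    have h0 : 0 ≤ k * (7 / n) := by positivity
    nlinarith
  set T : ℂ → ℂ := fun z => (2 * Real.pi * Complex.I - logExcess k z) / n with hT
  have hnorm_n : ‖(n : ℂ)‖ = n := by rw [Complex.norm_real, Real.norm_of_nonneg hn.le]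
  have hdist : ∀ x y : ℂ, ‖x‖ ≤ 7 / n → ‖y‖ ≤ 7 / n → ‖T y - T x‖ ≤ 1 / 2 * ‖y - x‖ := by
    intro x y hx hy
    have h1 : T y - T x = -(logExcess k y - logExcess k x) / n := by simp only [hT]; ring
    rw [h1, norm_div, norm_neg, hnorm_n]
    calc ‖logExcess k y - logExcess k x‖ / n ≤ 4 * k ^ 2 * (7 / n) * ‖y - x‖ / n := by
          gcongr; exact norm_logExcess_sub_le hk hr hx hy
      _ = 4 * k ^ 2 * (7 / n) / n * ‖y - x‖ := by ring
      _ ≤ _ := by gcongr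
  have hmaps : Set.MapsTo T (Metric.closedBall 0 (7 / n)) (Metric.closedBall 0 (7 / n)) := by
    intro z hz
    have hz : ‖z‖ ≤ 7 / n := by simpa using hz
    have h1 := norm_logExcess_sub_le hk hr (x := 0) (by simp; positivity) hz
    rw [logExcess_zero, sub_zero, sub_zero] at h1
    have h2 : ‖logExcess k z‖ ≤ 4 * (k * (7 / n)) ^ 2 := by
      refine h1.trans ?_
      calc 4 * k ^ 2 * (7 / n) * ‖z‖ ≤ 4 * k ^ 2 * (7 / n) * (7 / n) := by gcongr
        _ = _ := by ring
    have h3 : ‖2 * Real.pi * Complex.I - logExcess k z‖ ≤ 7 := by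
      refine (norm_sub_le _ _).trans ?_
      have : ‖2 * (Real.pi : ℂ) * Complex.I‖ = 2 * Real.pi := by
        simp [abs_of_pos Real.pi_pos]
      rw [this]
      have h0 : 0 ≤ k * (7 / n) := by positivity
      nlinarith [Real.pi_lt_d2]
    simp only [hT, mem_closedBall_zero_iff, norm_div, hnorm_n]
    gcongr
  have hcontr : ContractingWith (1 / 2) hmaps.restrict := by
    refine ⟨by norm_num, LipschitzWith.of_dist_le_mul fun x y => ?_⟩
    have hx : ‖(x : ℂ)‖ ≤ 7 / n := mem_closedBall_zero_iff.1 x.2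
    have hy : ‖(y : ℂ)‖ ≤ 7 / n := mem_closedBall_zero_iff.1 y.2
    simpa [Subtype.dist_eq, dist_eq_norm] using hdist y x hy hx
  obtain ⟨z, hz, hfix, -⟩ := ContractingWith.exists_fixedPoint' (x := 0)
    Metric.isClosed_closedBall.isComplete hmaps hcontr (by simp; positivity) (edist_ne_top _ _)
  refine ⟨z, by simpa using hz, ?_⟩
  have h1 : (2 * Real.pi * Complex.I - logExcess k z) / n = z := hfix
  have hn' : (n : ℂ) ≠ 0 := by exact_mod_cast hn.ne'
  rw [div_eq_iff hn'] at h1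
  rw [h1]; ring

/-- The eigenvalue of the motion of a single card which is closest to `exp (2 π i / n)`. -/
theorem exists_card_eigenvalue (n k : ℕ) (hk : 2 ≤ k) (hkn : 100 * k ≤ n) :
    ∃ z : ℂ, ‖z‖ ≤ 7 / n ∧
      Complex.exp z ^ (n - k) * (1 + k * (Complex.exp z - 1)) = 1 ∧
      |z.re + 2 * Real.pi ^ 2 * k * (k - 1) / n ^ 3| ≤ 4000 * (k : ℝ) ^ 3 / n ^ 4 := by
  have hk1 : (1 : ℝ) ≤ k := by exact_mod_cast (by omega : 1 ≤ k)
  have hknR : 100 * (k : ℝ) ≤ n := by exact_mod_cast hkn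
  have hn : (0 : ℝ) < n := by linarith
  obtain ⟨z, hz, h⟩ := exists_eq_two_pi_I_sub_logExcess hk1 hknR
  push_cast at h
  have hkr : (k : ℝ) * (7 / n) ≤ 7 / 100 := by
    rw [mul_div_assoc', div_le_div_iff₀ hn (by norm_num)]; linarith
  have hkz : (k : ℝ) * ‖z‖ ≤ 1 / 4 := by
    have : (k : ℝ) * ‖z‖ ≤ k * (7 / n) := by gcongr
    linarith
  refine ⟨z, hz, ?_, ?_⟩
  · have hne : 1 + (k : ℂ) * (Complex.exp z - 1) ≠ 0 := by
      intro h0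
      have := (half_le_norm_one_add hk1 hkz).2
      push_cast at this
      rw [h0, norm_zero] at this; norm_num at this
    rw [← Complex.exp_nat_mul]
    conv_lhs => rw [← Complex.exp_log hne]
    rw [← Complex.exp_add, Complex.exp_eq_one_iff]
    -- The winding number `1` separates this root from the trivial root `z = 0`.
    refine ⟨1, ?_⟩
    rw [Nat.cast_sub (by omega)]
    have h2 : Complex.log (1 + (k : ℂ) * (Complex.exp z - 1)) = logExcess k z + k * z := by
      simp [logExcess]
    rw [h2, sub_mul, h]; push_cast; ring
  · set u : ℂ := n * z - 2 * Real.pi * Complex.I with hu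
    have hu' : u = -logExcess k z := by rw [hu, h]; ring
    have h1 := norm_logExcess_sub_le (r := 7 / n) hk1 (by linarith) (x := 0)
      (by simp; positivity) hz
    rw [logExcess_zero, sub_zero, sub_zero] at h1
    have hun : ‖u‖ ≤ 196 * k ^ 2 / n ^ 2 := by
      rw [hu', norm_neg]
      refine h1.trans ?_
      calc 4 * (k : ℝ) ^ 2 * (7 / n) * ‖z‖ ≤ 4 * k ^ 2 * (7 / n) * (7 / n) := by gcongr
        _ = _ := by ring
    have h3 := norm_logExcess_add_le hk1 hkz
    push_cast at h3
    have h4 : ‖(k : ℂ) * (k - 1) * z ^ 2 / 2 - u‖ ≤ 6 * k ^ 3 * (7 / n) ^ 3 := by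
      rw [hu', sub_neg_eq_add, add_comm]
      refine h3.trans ?_
      gcongr
    -- A difference of squares: it measures the error in replacing `z²` by `(2πi/n)²`.
    have h5 : (n : ℂ) ^ 2 * z ^ 2 + 4 * Real.pi ^ 2 = u * (n * z + 2 * Real.pi * Complex.I) := by
      rw [hu]; ring_nf; rw [Complex.I_sq]; ring
    have h6 : ‖(n : ℂ) * z + 2 * Real.pi * Complex.I‖ ≤ 14 := by
      refine (norm_add_le _ _).trans ?_
      have h7 : ‖2 * (Real.pi : ℂ) * Complex.I‖ = 2 * Real.pi := by
        simp [abs_of_pos Real.pi_pos]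
      rw [h7, norm_mul, Complex.norm_natCast]
      have : (n : ℝ) * ‖z‖ ≤ 7 := by
        calc (n : ℝ) * ‖z‖ ≤ n * (7 / n) := by gcongr
          _ = 7 := by field_simp
      nlinarith [Real.pi_lt_d2]
    have h9 : |(u + 2 * Real.pi ^ 2 * k * (k - 1) / n ^ 2 : ℂ).re| ≤ 4000 * k ^ 3 / n ^ 3 := by
      refine (Complex.abs_re_le_norm _).trans ?_
      have hn' : (n : ℂ) ≠ 0 := by exact_mod_cast hn.ne'
      have e1 : (u + 2 * Real.pi ^ 2 * k * (k - 1) / n ^ 2 : ℂ) =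
          -((k : ℂ) * (k - 1) * z ^ 2 / 2 - u) + (k * (k - 1) / 2 / n ^ 2) *
            (u * (n * z + 2 * Real.pi * Complex.I)) := by
        rw [← h5]; field_simp; ring
      rw [e1]
      refine (norm_add_le _ _).trans ?_
      rw [norm_neg, norm_mul, norm_mul]
      have h10 : ‖(k * (k - 1) / 2 / n ^ 2 : ℂ)‖ ≤ k ^ 2 / 2 / n ^ 2 := by
        rw [show (k * (k - 1) / 2 / n ^ 2 : ℂ) = ((k * (k - 1) / 2 / n ^ 2 : ℝ) : ℂ) by push_cast; ring,
          Complex.norm_real, Real.norm_of_nonneg]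
        · gcongr; nlinarith
        · have : (0 : ℝ) ≤ k - 1 := by linarith
          positivity
      have hx : (k : ℝ) / n ≤ 1 / 100 := by
        rw [div_le_div_iff₀ hn (by norm_num)]; linarith
      calc _ ≤ 6 * (k : ℝ) ^ 3 * (7 / n) ^ 3 + k ^ 2 / 2 / n ^ 2 * (196 * k ^ 2 / n ^ 2 * 14) := by
            gcongr
        _ = (k / n) ^ 3 * (2058 + 1372 * (k / n)) := by field_simp; ring
        _ ≤ (k / n) ^ 3 * 4000 := by gcongr; linarith
        _ = _ := by field_simp
    have h11 : (u + 2 * Real.pi ^ 2 * k * (k - 1) / n ^ 2 : ℂ).re =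
        n * (z.re + 2 * Real.pi ^ 2 * k * (k - 1) / n ^ 3) := by
      have : (2 * Real.pi ^ 2 * k * (k - 1) / n ^ 2 : ℂ) =
        ((2 * Real.pi ^ 2 * k * (k - 1) / n ^ 2 : ℝ) : ℂ) := by push_cast; ring
      rw [Complex.add_re, this, Complex.ofReal_re]
      have : u.re = n * z.re := by simp [hu]
      rw [this]; field_simp
    rw [h11, abs_mul, abs_of_pos hn] at h9
    calc _ = (n : ℝ) * |z.re + 2 * Real.pi ^ 2 * k * (k - 1) / n ^ 3| / n := by field_simp
      _ ≤ (4000 * (k : ℝ) ^ 3 / n ^ 3) / n := by gcongr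
      _ = _ := by field_simp

/-! ### Assembly of the two bounds -/

theorem half_le_one_sub_exp_neg {x : ℝ} (h0 : 0 ≤ x) (h1 : x ≤ 1) :
    x / 2 ≤ 1 - Real.exp (-x) := by
  have h2 : Real.exp (-x) ≤ 1 / (1 + x) := by
    rw [Real.exp_neg, ← one_div]
    gcongr
    linarith [Real.add_one_le_exp x]
  have h3 : 1 / (1 + x) ≤ 1 - x / 2 := by
    rw [div_le_iff₀ (by linarith)]; nlinarith
  linarith

/-- In Wilson's inequality the left side is about `n² exp(-2ρt)` with `ρ = -Re z`. On the right, the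
squared increment is `O(k²/n²)` and the gap is at least of order `k²/n³`, so the quotient is `O(n)`;
one power of `n` survives, hence `log n`. -/
theorem log_sub_le_of_tvDist_le {n k t : ℕ} (hk : 2 ≤ k) (hkn : 1000 * k ≤ n)
    (ht : tvDist ((bottomToTopMatrix n k ^ t) 1) (uniformDeck n) ≤ 1 / 4) :
    Real.log n - Real.log 3300 ≤
      2 * ((1 + 500 * (k / n)) * (2 * Real.pi ^ 2 * k * (k - 1) / n ^ 3)) * t := by
  obtain ⟨z, hz, hroot, hre⟩ := exists_card_eigenvalue n k hk (by omega)
  have hk2 : (2 : ℝ) ≤ k := by exact_mod_cast hk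
  have hknR : 1000 * (k : ℝ) ≤ n := by exact_mod_cast hkn
  have hn : (0 : ℝ) < n := by linarith
  set q : ℝ := 2 * Real.pi ^ 2 * k * (k - 1) / n ^ 3 with hq
  set x : ℝ := (k : ℝ) / n with hx
  set ρ : ℝ := -z.re with hρ
  have hx0 : 0 < x := by positivity
  have hx1 : x ≤ 1 / 1000 := by rw [hx, div_le_div_iff₀ hn (by norm_num)]; linarith
  have hpi : 9 ≤ Real.pi ^ 2 := by nlinarith [Real.pi_gt_three]
  have hpi' : Real.pi ^ 2 ≤ 10 := by nlinarith [Real.pi_lt_d2, Real.pi_pos]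
  have hkk : (k : ℝ) ^ 2 ≤ 2 * (k * (k - 1)) := by nlinarith
  have hq1 : 9 * (k : ℝ) ^ 2 / n ^ 3 ≤ q := by
    rw [hq]
    refine div_le_div_of_nonneg_right ?_ (by positivity)
    nlinarith [mul_nonneg (by linarith : (0 : ℝ) ≤ k) (by linarith : (0 : ℝ) ≤ k - 1)]
  have hq2 : n * q ≤ 20 * x ^ 2 := by
    have : n * q = 2 * Real.pi ^ 2 * (k * (k - 1)) / n ^ 2 := by rw [hq]; field_simp
    rw [this, hx, div_pow, mul_div_assoc']
    refine div_le_div_of_nonneg_right ?_ (by positivity)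
    exact mul_le_mul (by linarith) (by nlinarith) (by nlinarith) (by norm_num)
  have hq0 : 0 < q := lt_of_lt_of_le (by positivity) hq1
  -- `k ≥ 2` makes `k(k-1)` comparable to `k²`, so the error in `Re z` is a relative error `O(k/n)`
  -- of `q`.
  have herr : 4000 * (k : ℝ) ^ 3 / n ^ 4 ≤ 500 * x * q := by
    calc 4000 * (k : ℝ) ^ 3 / n ^ 4 = 4000 / 9 * x * (9 * (k : ℝ) ^ 2 / n ^ 3) := by
          rw [hx]; field_simp
      _ ≤ 500 * x * q := by gcongr; norm_num
  have hre' : |q - ρ| ≤ 500 * x * q := by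
    rw [hρ, sub_neg_eq_add, add_comm]; exact hre.trans herr
  obtain ⟨hl, hu⟩ := abs_le.1 hre'
  have hρ1 : ρ ≤ (1 + 500 * x) * q := by linarith
  have hρ2 : q / 2 ≤ ρ := by nlinarith
  have hρ3 : ρ ≤ 3 / 2 * q := by nlinarith
  have hnρ : n * ρ ≤ 1 / 1000 := by
    calc n * ρ ≤ n * (3 / 2 * q) := by gcongr
      _ = 3 / 2 * (n * q) := by ring
      _ ≤ 3 / 2 * (20 * x ^ 2) := by gcongr
      _ ≤ 1 / 1000 := by nlinarith
  have hρ0 : 0 < ρ := by linarith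
  have hn1 : (1 : ℝ) ≤ n := by linarith
  have hρs : ρ ≤ 1 / 1000 := le_trans (le_mul_of_one_le_left hρ0.le hn1) hnρ
  have hlam : ‖Complex.exp z‖ = Real.exp (-ρ) := by rw [Complex.norm_exp, hρ, neg_neg]
  have hlam1 : ‖Complex.exp z‖ < 1 := by
    rw [hlam, Real.exp_lt_one_iff]; linarith
  have hmain := norm_pow_mul_deckFunction_le (by omega) (by omega) hlam1 hroot ht
  have hz1 : ‖z‖ ≤ 1 := hz.trans (by rw [div_le_one hn]; linarith)
  have h1lam : ‖1 - Complex.exp z‖ ≤ 14 / n := by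
    rw [norm_sub_rev]
    refine (norm_exp_sub_one_le_two hz1).trans ?_
    calc 2 * ‖z‖ ≤ 2 * (7 / n) := by gcongr
      _ = _ := by ring
  have hgap : q / 2 ≤ 1 - ‖Complex.exp z‖ ^ 2 := by
    rw [hlam, ← Real.exp_nat_mul]
    have := half_le_one_sub_exp_neg (x := 2 * ρ) (by linarith) (by linarith)
    have e : ((2 : ℕ) : ℝ) * -ρ = -(2 * ρ) := by push_cast; ring
    rw [e]; linarith
  have hrhs : 6 * ((2 * k * ‖1 - Complex.exp z‖) ^ 2 / (1 - ‖Complex.exp z‖ ^ 2)) ≤ 1100 * n := by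
    calc 6 * ((2 * (k : ℝ) * ‖1 - Complex.exp z‖) ^ 2 / (1 - ‖Complex.exp z‖ ^ 2))
        ≤ 6 * ((2 * (k : ℝ) * (14 / n)) ^ 2 / (9 * (k : ℝ) ^ 2 / n ^ 3 / 2)) := by
          gcongr
          exact le_trans (by linarith) hgap
      _ = 6 * 1568 / 9 * (n : ℝ) := by field_simp; ring
      _ ≤ 1100 * (n : ℝ) := by gcongr; norm_num
  have hlhs : ‖Complex.exp z‖ ^ (2 * t) * (n * ‖Complex.exp z‖ ^ (2 * n)) ^ 2 =
      n ^ 2 * Real.exp (-(2 * ρ * t)) * Real.exp (-(4 * (n * ρ))) := by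
    rw [hlam, ← Real.exp_nat_mul, ← Real.exp_nat_mul, mul_pow, ← Real.exp_nat_mul]
    push_cast
    rw [show 2 * (t : ℝ) * -ρ = -(2 * ρ * t) by ring,
      show 2 * (2 * (n : ℝ) * -ρ) = -(4 * (n * ρ)) by ring]
    ring
  have hexp : 1 / 3 ≤ Real.exp (-(4 * (n * ρ))) := by
    have := Real.add_one_le_exp (-(4 * (n * ρ)))
    linarith
  rw [hlhs] at hmain
  have h1 : (n : ℝ) ^ 2 * Real.exp (-(2 * ρ * t)) * (1 / 3) ≤ 1100 * n :=
    le_trans (by gcongr) (hmain.trans hrhs)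
  have h2 : (n : ℝ) * Real.exp (-(2 * ρ * t)) ≤ 3300 := by
    refine le_of_mul_le_mul_left ?_ hn
    linarith
  rw [Real.exp_neg, ← div_eq_mul_inv, div_le_iff₀ (Real.exp_pos _)] at h2
  have h3 := Real.log_le_log hn h2
  rw [Real.log_mul (by norm_num) (Real.exp_pos _).ne', Real.log_exp] at h3
  have h4 : 2 * ρ * t ≤ 2 * ((1 + 500 * x) * q) * t := by gcongr
  linarith

theorem theorem4p4 (k : ℕ → ℕ) (hk : ∀ᶠ n in atTop, 2 ≤ k n ∧ k n ≤ n) :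
    ((fun n : ℕ => (k n : ℝ)) =o[atTop] (fun n : ℕ => (n : ℝ)) →
      ∃ ε : ℕ → ℝ, Tendsto ε atTop (𝓝 0) ∧
        ∀ᶠ n : ℕ in atTop,
          ENNReal.ofReal ((1 + ε n) *
              ((n : ℝ) ^ 3 / (4 * Real.pi ^ 2 * (k n : ℝ) * ((k n : ℝ) - 1))) *
              Real.log (n : ℝ)) ≤
            (bottomToTopMixingTime n (k n) : ℝ≥0∞)) ∧
    ((fun n : ℕ => (k n : ℝ)) =Θ[atTop] (fun n : ℕ => (n : ℝ)) →
      ∃ c : ℝ, 0 < c ∧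
        ∀ᶠ n : ℕ in atTop,
          ENNReal.ofReal (c * (n : ℝ) * Real.log (n : ℝ)) ≤
            (bottomToTopMixingTime n (k n) : ℝ≥0∞)) := by
  have hlog : Tendsto (fun n : ℕ => Real.log (n : ℝ)) atTop atTop :=
    Real.tendsto_log_atTop.comp tendsto_natCast_atTop_atTop
  constructor
  · intro hko
    -- This `1 + ε n` is what remains on solving `log_sub_le_of_tvDist_le` for `t` and factoring out
    -- the main term.
    refine ⟨fun n => (1 - Real.log 3300 / Real.log n) / (1 + 500 * ((k n : ℝ) / n)) - 1, ?_, ?_⟩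
    · have h1 : Tendsto (fun n : ℕ => Real.log 3300 / Real.log (n : ℝ)) atTop (𝓝 0) :=
        hlog.const_div_atTop _
      have h2 : Tendsto (fun n : ℕ => (k n : ℝ) / n) atTop (𝓝 0) := hko.tendsto_div_nhds_zero
      have h3 := (((h1.const_sub 1).div ((h2.const_mul 500).const_add 1) (by norm_num)).sub_const 1)
      simpa using h3
    · filter_upwards [hk, hko.bound (by norm_num : (0 : ℝ) < 1 / 1000),
        hlog.eventually_gt_atTop 0] with n hn hno hlogn
      obtain ⟨hk2, hkn⟩ := hn
      have hkn' : 1000 * k n ≤ n := by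
        rw [Real.norm_natCast, Real.norm_natCast] at hno
        have : 1000 * (k n : ℝ) ≤ n := by linarith
        exact_mod_cast this
      refine ofReal_le_mixingTime _ _ 1 _ fun t ht => ?_
      have h := log_sub_le_of_tvDist_le hk2 hkn' ht
      have hk2R : (2 : ℝ) ≤ k n := by exact_mod_cast hk2
      have hk1 : (0 : ℝ) < (k n : ℝ) - 1 := by linarith
      have hn0 : (0 : ℝ) < n := by exact_mod_cast (by omega : 0 < n)
      have hq : 0 < 2 * ((1 + 500 * ((k n : ℝ) / n)) *
          (2 * Real.pi ^ 2 * k n * (k n - 1) / n ^ 3)) := by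
        have := Real.pi_pos
        positivity
      rw [← div_le_iff₀' hq] at h
      refine le_trans (le_of_eq ?_) h
      have hden : 1 + 500 * ((k n : ℝ) / n) ≠ 0 := by positivity
      have := Real.pi_pos.ne'
      have := hk1.ne'
      rw [add_sub_cancel]
      generalize 1 + 500 * ((k n : ℝ) / n) = D at hden ⊢
      field_simp
      ring
  · intro hkΘ
    obtain ⟨C, hC, hCn⟩ := hkΘ.2.exists_pos
    refine ⟨1 / (2 * C), by positivity, ?_⟩
    filter_upwards [hk, hCn.bound, hlog.eventually_ge_atTop (2 * Real.log 8),
      eventually_gt_atTop 0] with n hn hno hlogn hn0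
    obtain ⟨hk2, hkn⟩ := hn
    refine ofReal_le_mixingTime _ _ 1 _ fun t ht => ?_
    have h := mul_log_le_of_tvDist_le hk2 hkn ht
    rw [Real.norm_natCast, Real.norm_natCast] at hno
    have hnR : (0 : ℝ) < n := by exact_mod_cast hn0
    have hlog8 : 0 < Real.log 8 := Real.log_pos (by norm_num)
    -- Once `log n ≥ 2 log 8`, dropping the factor `8` costs at most half of `log n`; this is the
    -- `2` in `1 / (2 * C)`, while `C` comes from `n ≤ C k`.
    have h1 : Real.log n / 2 ≤ Real.log (((n : ℝ) + 1) / 8) := by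
      rw [Real.log_div (by positivity) (by norm_num)]
      have := Real.log_le_log hnR (by linarith : (n : ℝ) ≤ n + 1)
      linarith
    calc 1 / (2 * C) * n * Real.log n ≤ 1 / (2 * C) * (C * k n) * Real.log n := by gcongr
      _ = k n * (Real.log n / 2) := by field_simp
      _ ≤ k n * Real.log (((n : ℝ) + 1) / 8) := by gcongr
      _ ≤ t := h
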